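/- Let $Y_1,Y_2,\ldots$ be independent random variables with values in $\{0,1\}$ and $p_\ell=\mathbb P(Y_\ell=1)\in(0,1)$, where the sequence $p_1,p_2,\ldots$ is periodic with minimal period $r$. Let $d\ge 1$ be an integer and let $r$ and $d$ share a common divisor greater than $1$. For $1\le i\le d$ put $$Z_i^n=\frac1{\lfloor n/d\rfloor}\sum_{k=0}^{\lfloor n/d\rfloor-1}Y_{i+kd},$$ and for every integer $i\ge1$ put $$e_i=\frac1r\sum_{k=0}^{r-1}p_{i+kd},\qquad v_i=\frac1r\sum_{k=0}^{r-1}\mathrm{Var}(Y_{i+kd}).$$ Let $q=\lfloor (d-1)/2\rfloor$ and $\omega_j=2\pi j/d$. For $x\in\mathbb R^d$ let $I_x(\omega_j)=\frac1d\bigl|\sum_{\ell=1}^d x_\ell e^{-i\ell\omega_j}\bigr|^2$, $$A=\{x\in\mathbb R^d: I_x(\omega_1)=\dots=I_x(\omega_q)=0\},\qquad g(x)=\frac{\max_{1\le j\le q}I_x(\omega_j)}{\sum_{m=1}^q I_x(\omega_m)}\quad(x\notin A),$$ with $g(x)=0$ for $x\in A$ by convention (if $d\le 2$, then $q=0$ and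 $A=\mathbb R^d$), and let $f(x)=g(x)\mathbf 1_{\{x\notin A\}}$. Write $Z^n=(Z_1^n,\dots,Z_d^n)$. (a) If $r=2$, then $(e_1,\ldots,e_d)\in A$, and for i.i.d. standard normal random variables $N_1,\dots,N_d$, as $n\to\infty$, $$f(Z^n)\to g\bigl(\sqrt{v_1}N_1,\sqrt{v_2}N_2,\sqrt{v_1}N_3,\ldots,\sqrt{v_2}N_d\bigr)\quad\text{in law;}$$ moreover, if $d\ge3$, the argument of $g$ on the right lies outside $A$ almost surely. (b) If $r\ge3$, $b=\gcd(r,d)\ge 3$ and $$\sum_{k=1}^r e_k\exp\Bigl(-\frac{2\pi i k}{b}\Bigr)\Bigl(\Bigl\lfloor\frac{d-k}{r}\Bigr\rfloor+1\Bigr)\ne0,$$ then $(e_1,\ldots,e_d)\notin A$ and $f(Z^n)\to g(e_1,\ldots,e_d)$ in probability as $n\to\infty$. -/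

import Mathlib

open MeasureTheory ProbabilityTheory Filter
open scoped Topology

noncomputable section

namespace PeriodTest

/-- `q = ⌊(d - 1) / 2⌋`, the number of Fourier frequencies in `(0, π)` for a series of
length `d`. -/
def numFreq (d : ℕ) : ℕ := (d - 1) / 2

/-- The `j`-th Fourier frequency `ω_j = 2 π j / d`. -/
def freq (d j : ℕ) : ℝ := 2 * Real.pi * j / d

/-- The periodogram `I_x(ω) = (1 / d) |∑_{ℓ=1}^d x_ℓ exp(-i ℓ ω)|²` of a series
`x = (x_1, …, x_d)`; the entry `x_ℓ` is `x ⟨ℓ - 1, _⟩`. -/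
def periodogram {d : ℕ} (x : Fin d → ℝ) (ω : ℝ) : ℝ :=
  1 / (d : ℝ) *
    ‖∑ l : Fin d, (x l : ℂ) * Complex.exp (-(Complex.I * (((l : ℕ) + 1 : ℕ) : ℂ) * (ω : ℂ)))‖ ^ 2

/-- Fisher's statistic `g(x) = max_{1 ≤ j ≤ q} I_x(ω_j) / ∑_{1 ≤ m ≤ q} I_x(ω_m)`.
The supremum is over a finite set, hence a maximum if `q ≥ 1`; the value is `0` if `q = 0`
or if the denominator vanishes. -/
def fisherG {d : ℕ} (x : Fin d → ℝ) : ℝ :=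
  (⨆ j : Finset.Icc 1 (numFreq d), periodogram x (freq d j)) /
    ∑ m ∈ Finset.Icc 1 (numFreq d), periodogram x (freq d m)

/-- The set `A` of all series with `I_x(ω_1) = … = I_x(ω_q) = 0`. -/
def setA (d : ℕ) : Set (Fin d → ℝ) :=
  {x | ∀ j ∈ Finset.Icc 1 (numFreq d), periodogram x (freq d j) = 0}

/-- The test statistic `f = g · 1_{Aᶜ}`. -/
def testStat {d : ℕ} (x : Fin d → ℝ) : ℝ := (setA d)ᶜ.indicator fisherG x

/-- `r` is the minimal period of the sequence `p_1, p_2, …` (the value `p 0` plays no role). -/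
def IsMinimalPeriod (p : ℕ → ℝ) (r : ℕ) : Prop :=
  IsLeast {s : ℕ | 0 < s ∧ ∀ l m : ℕ, 1 ≤ l → p (m * s + l) = p l} r

/-- `Z_i^n = (1 / ⌊n/d⌋) ∑_{k=0}^{⌊n/d⌋-1} Y_{i+kd}`. -/
def blockMean {Ω : Type*} (Y : ℕ → Ω → ℝ) (d n i : ℕ) (ω : Ω) : ℝ :=
  1 / ((n / d : ℕ) : ℝ) * ∑ k ∈ Finset.range (n / d), Y (i + k * d) ω

/-- The series `Z^n = (Z_1^n, …, Z_d^n)`. -/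
def blockSeries {Ω : Type*} (Y : ℕ → Ω → ℝ) (d n : ℕ) (ω : Ω) : Fin d → ℝ :=
  fun i => blockMean Y d n ((i : ℕ) + 1) ω

/-- `e_i = (1 / r) ∑_{k=0}^{r-1} p_{i+kd}`. -/
def limMean (p : ℕ → ℝ) (r d i : ℕ) : ℝ :=
  1 / (r : ℝ) * ∑ k ∈ Finset.range r, p (i + k * d)

/-- The vector `(e_1, …, e_d)`. -/
def limSeries (p : ℕ → ℝ) (r d : ℕ) : Fin d → ℝ :=
  fun i => limMean p r d ((i : ℕ) + 1)

/-- `v_i = (1 / r) ∑_{j=0}^{r-1} Var(Y_{i+jd})`. -/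
def limVar {Ω : Type*} [MeasurableSpace Ω] (P : Measure Ω) (Y : ℕ → Ω → ℝ) (r d i : ℕ) : ℝ :=
  1 / (r : ℝ) * ∑ j ∈ Finset.range r, variance (Y (i + j * d)) P

/-- The vector `(s x_1, t x_2, s x_3, t x_4, …)`: odd-numbered entries (even `Fin` index) are
multiplied by `s`, even-numbered ones by `t`. -/
def altScale {d : ℕ} (s t : ℝ) (x : Fin d → ℝ) : Fin d → ℝ :=
  fun i => (if Even (i : ℕ) then s else t) * x i

end PeriodTest

end

/-! If `e ∈ A`, then at the frequencies `ω_1, …, ω_q` the periodogram ignores a shift by `e`, and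
scaling by `c` multiplies it by `c²`. Hence `g(c(z - e)) = g(z)` for `c ≠ 0` (`fisherG_smul_sub`).

(a) Here `d` is even and `e` alternates, so `e ∈ A` (`mem_setA_of_alternating`) and, with `m = ⌊n/d⌋
≥ 1`, `f(Z^n) = g(√m (Z^n - e))`. Each coordinate is a normalised i.i.d. sum because `2 ∣ d`, and
the coordinates are independent, so the CLT holds jointly (`tendstoInDistribution_blockSums`). For
`d ≥ 3` the Gaussian limit almost surely avoids `A`, off which `g` is continuous, and continuous
mapping applies.

(b) The frequency `2π/b` is `ω_{d/b}`. Grouping the transform of `e` there by residues mod `r` gives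
the sum assumed non-zero, so `e ∉ A` (`limSeries_notMem_setA`). A weak law gives `Z^n → e`, and `g`
is continuous at `e`. -/

namespace PeriodTest

/-! ### Invariance and continuity of Fisher's statistic -/

section Fisher

variable {d : ℕ}

lemma continuous_periodogram (ω : ℝ) : Continuous fun x : Fin d → ℝ => periodogram x ω := by
  unfold periodogram
  fun_prop

lemma periodogram_nonneg (x : Fin d → ℝ) (ω : ℝ) : 0 ≤ periodogram x ω := by
  unfold periodogram
  positivity

lemma periodogram_eq_zero_iff (hd : d ≠ 0) (x : Fin d → ℝ) (ω : ℝ) :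
    periodogram x ω = 0 ↔ ∑ l : Fin d, (x l : ℂ) *
      Complex.exp (-(Complex.I * (((l : ℕ) + 1 : ℕ) : ℂ) * (ω : ℂ))) = 0 := by
  simp [periodogram, hd]

lemma periodogram_smul_sub {e : Fin d → ℝ} {ω : ℝ} (he : periodogram e ω = 0) (c : ℝ)
    (z : Fin d → ℝ) : periodogram (c • (z - e)) ω = c ^ 2 * periodogram z ω := by
  rcases eq_or_ne d 0 with rfl | hd
  · simp [periodogram]
  rw [periodogram_eq_zero_iff hd] at he
  have key : ∑ l : Fin d, (((c • (z - e)) l : ℝ) : ℂ) *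
      Complex.exp (-(Complex.I * (((l : ℕ) + 1 : ℕ) : ℂ) * (ω : ℂ))) =
      (c : ℂ) * ∑ l : Fin d, (z l : ℂ) *
      Complex.exp (-(Complex.I * (((l : ℕ) + 1 : ℕ) : ℂ) * (ω : ℂ))) := by
    rw [← sub_zero (∑ l : Fin d, (z l : ℂ) * _), ← he, ← Finset.sum_sub_distrib, Finset.mul_sum]
    refine Finset.sum_congr rfl fun l _ => ?_
    simp only [Pi.smul_apply, Pi.sub_apply, smul_eq_mul]
    push_cast
    ring
  unfold periodogram
  rw [key, norm_mul, mul_pow, Complex.norm_real, Real.norm_eq_abs, sq_abs]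
  ring

lemma sum_periodogram_eq_zero_iff (x : Fin d → ℝ) :
    ∑ m ∈ Finset.Icc 1 (numFreq d), periodogram x (freq d m) = 0 ↔ x ∈ setA d :=
  Finset.sum_eq_zero_iff_of_nonneg fun _ _ => periodogram_nonneg _ _

/-- On `A` the denominator vanishes and division by zero gives `0`, so the indicator is redundant.
-/
lemma testStat_eq_fisherG (x : Fin d → ℝ) : testStat x = fisherG x := by
  by_cases hx : x ∈ setA d
  · simp [testStat, hx, fisherG, (sum_periodogram_eq_zero_iff x).2 hx]
  · simp [testStat, hx]

lemma fisherG_smul_sub {e : Fin d → ℝ} (he : e ∈ setA d) {c : ℝ} (hc : c ≠ 0) (z : Fin d → ℝ) :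
    fisherG (c • (z - e)) = fisherG z := by
  unfold fisherG
  have h1 : (⨆ j : Finset.Icc 1 (numFreq d), periodogram (c • (z - e)) (freq d j)) =
      c ^ 2 * ⨆ j : Finset.Icc 1 (numFreq d), periodogram z (freq d j) := by
    rw [Real.mul_iSup_of_nonneg (sq_nonneg c)]
    exact iSup_congr fun j => periodogram_smul_sub (he j j.2) c z
  have h2 : ∑ m ∈ Finset.Icc 1 (numFreq d), periodogram (c • (z - e)) (freq d m) =
      c ^ 2 * ∑ m ∈ Finset.Icc 1 (numFreq d), periodogram z (freq d m) := by
    rw [Finset.mul_sum]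
    exact Finset.sum_congr rfl fun j hj => periodogram_smul_sub (he j hj) c z
  rw [h1, h2, mul_div_mul_left _ _ (pow_ne_zero 2 hc)]

lemma measurable_fisherG : Measurable (fisherG : (Fin d → ℝ) → ℝ) := by
  refine Measurable.div (Measurable.iSup fun j => (continuous_periodogram _).measurable) ?_
  exact Finset.measurable_fun_sum _ fun j _ => (continuous_periodogram _).measurable

/-- Off `A` the denominator is non-zero. Also `q ≥ 1` there, so the supremum is a maximum over a
non-empty finite set. -/
lemma continuousAt_fisherG {x : Fin d → ℝ} (hx : x ∉ setA d) : ContinuousAt fisherG x := by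
  have hne : Nonempty (Finset.Icc 1 (numFreq d)) := by
    by_contra h
    exact hx fun j hj => (h ⟨⟨j, hj⟩⟩).elim
  refine ContinuousAt.div (Continuous.continuousAt ?_) (Continuous.continuousAt ?_)
    (mt (sum_periodogram_eq_zero_iff x).1 hx)
  · simp_rw [← Finset.sup'_univ_eq_ciSup]
    exact Continuous.finset_sup'_apply _ fun j _ => continuous_periodogram _
  · exact continuous_finsetSum _ fun m _ => continuous_periodogram _

/-- An alternating series has no mass at the Fourier frequencies in `(0, π)`. -/
lemma mem_setA_of_alternating (hd : Even d) {x : Fin d → ℝ} {s t : ℝ}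
    (hx : ∀ i : Fin d, x i = if Even (i : ℕ) then s else t) : x ∈ setA d := by
  intro j hj
  rw [Finset.mem_Icc, numFreq] at hj
  obtain ⟨n, rfl⟩ := hd
  have hn : n ≠ 0 := by omega
  rw [periodogram_eq_zero_iff (by omega)]
  set z : ℂ := Complex.exp (-(Complex.I * (freq (n + n) j : ℂ))) with hz
  have hexp : ∀ l : ℕ, Complex.exp (-(Complex.I * ((l + 1 : ℕ) : ℂ) * (freq (n + n) j : ℂ))) =
      z ^ (l + 1) := by
    intro l
    rw [hz, ← Complex.exp_nat_mul]
    congr 1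
    ring
  have hsum : ∀ m : ℕ, ∑ l ∈ Finset.range (m + m), (((if Even l then s else t : ℝ)) : ℂ) *
      z ^ (l + 1) = (s * z + t * z ^ 2) * ∑ k ∈ Finset.range m, (z ^ 2) ^ k := by
    intro m
    induction m with
    | zero => simp
    | succ m ih =>
      rw [show m + 1 + (m + 1) = m + m + 1 + 1 by ring, Finset.sum_range_succ,
        Finset.sum_range_succ, ih, Finset.sum_range_succ, if_pos ⟨m, rfl⟩,
        if_neg (by rw [Nat.even_add_one, not_not]; exact ⟨m, rfl⟩)]
      ring
  simp_rw [hx, hexp]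
  rw [Fin.sum_univ_eq_sum_range (fun l => (((if Even l then s else t : ℝ)) : ℂ) * z ^ (l + 1)),
    hsum]
  -- `z²` is the `(-j)`-th power of a primitive `n`-th root of unity and `0 < j < n`, so the
  -- geometric sum over the `n` pairs vanishes.
  have hz2 : z ^ 2 = Complex.exp (2 * Real.pi * Complex.I / n) ^ (- (j : ℤ)) := by
    rw [hz, ← Complex.exp_nat_mul, ← Complex.exp_int_mul, freq]
    congr 1
    have : (n : ℂ) ≠ 0 := by exact_mod_cast hn
    push_cast
    field_simp
    ring
  have hprim := Complex.isPrimitiveRoot_exp n hn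
  have hne : z ^ 2 ≠ 1 := by
    rw [hz2, Ne, hprim.zpow_eq_one_iff_dvd, dvd_neg, Int.natCast_dvd_natCast]
    exact fun h => absurd (Nat.le_of_dvd (by omega) h) (by omega)
  have hpow : (z ^ 2) ^ n = 1 := by
    rw [hz2, ← zpow_natCast, zpow_comm, zpow_natCast, hprim.pow_eq_one, one_zpow]
  rw [geom_sum_eq hne, hpow, sub_self, zero_div, mul_zero]

end Fisher

/-! ### Cesàro means of periodic sequences -/

section Periodic

lemma sum_range_add_periodic {a : ℕ → ℝ} {r : ℕ} (ha : Function.Periodic a r) (m : ℕ) :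
    ∑ k ∈ Finset.range r, a (m + k) = ∑ k ∈ Finset.range r, a k := by
  induction m with
  | zero => simp
  | succ m ih =>
    have h := Finset.sum_range_succ (fun k => a (m + k)) r
    rw [Finset.sum_range_succ', ha m, add_zero] at h
    rw [← ih, ← add_right_cancel h]
    exact Finset.sum_congr rfl fun k _ => by rw [add_right_comm, add_assoc]

/-- Cesàro means of a periodic sequence converge to the mean over one period. -/
lemma tendsto_cesaro_periodic {a : ℕ → ℝ} {r : ℕ} (hr : r ≠ 0) (ha : Function.Periodic a r) :
    Tendsto (fun m : ℕ => 1 / (m : ℝ) * ∑ k ∈ Finset.range m, a k) atTop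
      (𝓝 (1 / (r : ℝ) * ∑ k ∈ Finset.range r, a k)) := by
  set e := 1 / (r : ℝ) * ∑ k ∈ Finset.range r, a k with he
  -- Subtracting the linear drift leaves an `r`-periodic, hence bounded, sequence.
  set D : ℕ → ℝ := fun m => ∑ k ∈ Finset.range m, a k - m * e with hD
  have hr' : (r : ℝ) ≠ 0 := by exact_mod_cast hr
  have hper : Function.Periodic D r := by
    intro m
    simp only [hD]
    rw [Finset.sum_range_add, sum_range_add_periodic ha, he]
    push_cast
    field_simp
    ring
  obtain ⟨C, hC⟩ : ∃ C, ∀ m, |D m| ≤ C := by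
    refine ⟨∑ k ∈ Finset.range r, |D k|, fun m => ?_⟩
    rw [← hper.map_mod_nat m]
    exact Finset.single_le_sum (f := fun k => |D k|) (fun _ _ => abs_nonneg _)
      (Finset.mem_range.2 (Nat.mod_lt _ (Nat.pos_of_ne_zero hr)))
  have hlim : Tendsto (fun m : ℕ => D m / m) atTop (𝓝 0) := by
    refine squeeze_zero_norm (a := fun m : ℕ => C / m) (fun m => ?_)
      (tendsto_const_div_atTop_nhds_zero_nat C)
    rw [norm_div, Real.norm_eq_abs, Real.norm_natCast]
    exact div_le_div_of_nonneg_right (hC m) (Nat.cast_nonneg m)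
  have := hlim.add_const e
  rw [zero_add] at this
  refine this.congr' ?_
  filter_upwards [eventually_ne_atTop 0] with m hm
  have hm' : (m : ℝ) ≠ 0 := by exact_mod_cast hm
  simp only [hD]
  field_simp
  ring

end Periodic

/-! ### The Fourier transform of the limit series -/

section LimitSeries

variable {p : ℕ → ℝ} {r d : ℕ}

lemma IsMinimalPeriod.add_eq (hr : IsMinimalPeriod p r) {l : ℕ} (hl : 1 ≤ l) (m : ℕ) :
    p (l + m * r) = p l := by
  rw [add_comm]
  exact hr.1.2 l m hl

lemma IsMinimalPeriod.periodic (hr : IsMinimalPeriod p r) {i : ℕ} (hi : 1 ≤ i) :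
    Function.Periodic (fun k => p (i + k * d)) r := by
  intro k
  change p (i + (k + r) * d) = p (i + k * d)
  rw [show i + (k + r) * d = (i + k * d) + d * r by ring]
  exact hr.add_eq (by omega) d

lemma limMean_add_mul (hr : IsMinimalPeriod p r) {i : ℕ} (hi : 1 ≤ i) (m : ℕ) :
    limMean p r d (i + m * r) = limMean p r d i := by
  unfold limMean
  congr 1
  refine Finset.sum_congr rfl fun k _ => ?_
  rw [add_right_comm]
  exact hr.add_eq (by omega) m

/-- The number of integers `l ≤ d` with `l ≡ k mod r`, `l ≥ 1`, written as a floor. -/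
lemma floor_sub_div_add_one (hr : 0 < r) {k : ℕ} (hk : k ∈ Finset.Icc 1 r) :
    ⌊((d : ℝ) - (k : ℝ)) / (r : ℝ)⌋ + 1 = (((d + r - k) / r : ℕ) : ℤ) := by
  rw [Finset.mem_Icc] at hk
  -- Adding `1` before taking the floor makes the numerator non-negative, as `k ≤ r`, so
  -- natural-number division agrees with the floor.
  have h : ((d : ℝ) - k) / r + 1 = ((d + r - k : ℕ) : ℝ) / r := by
    have : (r : ℝ) ≠ 0 := by positivity
    rw [Nat.cast_sub (by omega)]
    push_cast
    field_simp
    ring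
  have h2 : ⌊((d : ℝ) - k) / r + 1⌋ = (((d + r - k) / r : ℕ) : ℤ) := by
    rw [h, ← Int.natCast_floor_eq_floor (by positivity), Nat.floor_div_natCast, Nat.floor_natCast]
  rw [← h2, Int.floor_add_one]

/-- A sum of an `r`-periodic function over `1, …, d`, grouped by residues mod `r`. -/
lemma sum_range_eq_sum_residues (hr : 0 < r) (d : ℕ) {F : ℕ → ℂ}
    (hF : ∀ i, 1 ≤ i → ∀ m, F (i + m * r) = F i) :
    ∑ l ∈ Finset.range d, F (l + 1) = ∑ k ∈ Finset.Icc 1 r, F k * (((d + r - k) / r : ℕ) : ℂ) := by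
  induction d with
  | zero =>
    rw [Finset.sum_range_zero]
    refine (Finset.sum_eq_zero fun k hk => ?_).symm
    rw [Finset.mem_Icc] at hk
    rw [Nat.div_eq_of_lt (by omega)]
    simp
  | succ d ih =>
    rw [Finset.sum_range_succ, ih]
    have hmem : d % r + 1 ∈ Finset.Icc 1 r :=
      Finset.mem_Icc.2 ⟨by omega, Nat.mod_lt d hr⟩
    have hFd : F (d + 1) = F (d % r + 1) := by
      rw [← hF (d % r + 1) (by omega) (d / r)]
      congr 1
      have := Nat.mod_add_div d r
      rw [mul_comm (d / r)]
      omega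
    -- Passing from `d` to `d + 1` raises only the count of the residue class of `d + 1`.
    have hstep : ∀ k ∈ Finset.Icc 1 r, F k * (((d + 1 + r - k) / r : ℕ) : ℂ) =
        F k * (((d + r - k) / r : ℕ) : ℂ) + if k = d % r + 1 then F k else 0 := by
      intro k hk
      rw [Finset.mem_Icc] at hk
      rw [show d + 1 + r - k = (d + r - k) + 1 by omega, Nat.succ_div]
      have hiff : r ∣ d + r - k + 1 ↔ k = d % r + 1 := by
        have hs := Nat.mod_lt d hr
        -- The remaining term lies strictly between `0` and `2r`, so it is a multiple of `r` only if
        -- it equals `r`.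
        rw [show d + r - k + 1 = r * (d / r) + (d % r + r + 1 - k) by
          have := Nat.div_add_mod d r
          omega, Nat.dvd_add_right (dvd_mul_right r _)]
        constructor
        · rintro ⟨t, ht⟩
          have h1 : t ≠ 0 := by
            rintro rfl
            omega
          have h2 : t < 2 := by
            by_contra h2
            have := Nat.mul_le_mul_left r (not_lt.1 h2)
            omega
          rw [show t = 1 by omega] at ht
          omega
        · intro h
          rw [show d % r + r + 1 - k = r by omega]
      simp only [hiff]
      split_ifs <;> push_cast <;> ring
    rw [Finset.sum_congr rfl hstep, Finset.sum_add_distrib, Finset.sum_ite_eq' _ _ F, if_pos hmem,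
      hFd]

lemma limSeries_notMem_setA (hr : IsMinimalPeriod p r) (hd : 1 ≤ d) (hb : 3 ≤ Nat.gcd r d)
    (h : ∑ k ∈ Finset.Icc 1 r,
        (limMean p r d k : ℂ) *
          Complex.exp (-(2 * (Real.pi : ℂ) * Complex.I * (k : ℂ) / (Nat.gcd r d : ℂ))) *
          ((⌊((d : ℝ) - (k : ℝ)) / (r : ℝ)⌋ + 1 : ℤ) : ℂ) ≠ 0) :
    limSeries p r d ∉ setA d := by
  set b := Nat.gcd r d with hbdef
  have hrpos : 0 < r := hr.1.1
  obtain ⟨c, hc⟩ : b ∣ d := Nat.gcd_dvd_right r d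
  obtain ⟨c', hc'⟩ : b ∣ r := Nat.gcd_dvd_left r d
  have hcpos : 0 < c := Nat.pos_of_ne_zero (by rintro rfl; omega)
  have hb0 : (b : ℂ) ≠ 0 := by exact_mod_cast (show b ≠ 0 by omega)
  have hc0 : (c : ℂ) ≠ 0 := by exact_mod_cast hcpos.ne'
  -- The index `c = d/b` has frequency `2π/b`; `b ≥ 3` is what keeps it below `π`.
  have hmem : c ∈ Finset.Icc 1 (numFreq d) := by
    rw [Finset.mem_Icc, numFreq]
    have : 3 * c ≤ d := by rw [hc]; exact Nat.mul_le_mul_right c hb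
    omega
  intro hA
  have h0 := hA c hmem
  rw [periodogram_eq_zero_iff (by omega)] at h0
  apply h
  set F : ℕ → ℂ := fun k => (limMean p r d k : ℂ) *
    Complex.exp (-(2 * (Real.pi : ℂ) * Complex.I * (k : ℂ) / (b : ℂ))) with hFdef
  have hF : ∀ i, 1 ≤ i → ∀ m, F (i + m * r) = F i := by
    intro i hi m
    simp only [hFdef]
    rw [limMean_add_mul hr hi]
    congr 1
    -- Since `b ∣ r`, moving the index by `m * r` changes the exponent by `-2πi` times the integer
    -- `m * c'`.
    refine Complex.exp_eq_exp_iff_exists_int.2 ⟨-(m * c' : ℕ), ?_⟩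
    rw [hc']
    push_cast
    field_simp
    ring
  have hfloor : ∀ k ∈ Finset.Icc 1 r, F k * ((⌊((d : ℝ) - (k : ℝ)) / (r : ℝ)⌋ + 1 : ℤ) : ℂ) =
      F k * (((d + r - k) / r : ℕ) : ℂ) := by
    intro k hk
    rw [floor_sub_div_add_one hrpos hk, Int.cast_natCast]
  rw [Finset.sum_congr rfl hfloor, ← sum_range_eq_sum_residues hrpos d hF, ← h0,
    ← Fin.sum_univ_eq_sum_range (fun l => F (l + 1))]
  refine Finset.sum_congr rfl fun l _ => ?_
  simp only [hFdef, limSeries]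
  congr 2
  have hdc : (d : ℂ) = b * c := by exact_mod_cast hc
  rw [freq]
  push_cast
  rw [hdc]
  field_simp

end LimitSeries

/-! ### Moments and laws of `{0,1}`-valued variables -/

section Binary

variable {Ω : Type*} [MeasurableSpace Ω] {P : Measure Ω} {f g : Ω → ℝ}

lemma memLp_of_binary [IsProbabilityMeasure P] (hf : Measurable f) (hb : ∀ ω, f ω = 0 ∨ f ω = 1) (q : ENNReal) :
    MemLp f q P := by
  refine MemLp.of_bound hf.aestronglyMeasurable 1 (ae_of_all _ fun ω => ?_)
  rcases hb ω with h | h <;> simp [h]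

lemma integral_of_binary (hf : Measurable f) (hb : ∀ ω, f ω = 0 ∨ f ω = 1) :
    P[f] = P.real {ω | f ω = 1} := by
  have h : f = {ω | f ω = 1}.indicator 1 := by
    ext ω
    rcases hb ω with h | h <;> simp [h]
  conv_lhs => rw [h]
  exact integral_indicator_one (hf (measurableSet_singleton 1))

lemma variance_of_binary [IsProbabilityMeasure P] (hf : Measurable f) (hb : ∀ ω, f ω = 0 ∨ f ω = 1) :
    Var[f; P] = P.real {ω | f ω = 1} * (1 - P.real {ω | f ω = 1}) := by
  have h : f ^ 2 = f := by
    ext ω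
    rcases hb ω with h | h <;> simp [h]
  rw [variance_eq_sub (memLp_of_binary hf hb 2), h, integral_of_binary hf hb]
  ring

lemma variance_le_one_of_binary [IsProbabilityMeasure P] (hf : Measurable f) (hb : ∀ ω, f ω = 0 ∨ f ω = 1) :
    Var[f; P] ≤ 1 := by
  rw [variance_of_binary hf hb]
  nlinarith [sq_nonneg (P.real {ω | f ω = 1} - 1 / 2)]

/-- A `{0,1}`-valued law is determined by its mass at `1`; this supplies the identical distribution
needed for the CLT. -/
lemma identDistrib_of_binary [IsProbabilityMeasure P] (hf : Measurable f) (hg : Measurable g)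
    (hfb : ∀ ω, f ω = 0 ∨ f ω = 1) (hgb : ∀ ω, g ω = 0 ∨ g ω = 1)
    (h : P.real {ω | f ω = 1} = P.real {ω | g ω = 1}) : IdentDistrib f g P P := by
  classical
  have h1 : P (f ⁻¹' {1}) = P (g ⁻¹' {1}) := (measureReal_eq_measureReal_iff).1 h
  have key : ∀ {u : Ω → ℝ}, Measurable u → (∀ ω, u ω = 0 ∨ u ω = 1) → ∀ s : Set ℝ,
      P (u ⁻¹' s) = if (1 : ℝ) ∈ s then (if (0 : ℝ) ∈ s then 1 else P (u ⁻¹' {1}))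
        else (if (0 : ℝ) ∈ s then 1 - P (u ⁻¹' {1}) else 0) := by
    intro u hu hub s
    have hm := hu (measurableSet_singleton (1 : ℝ))
    split_ifs with h1 h0 h0
    · rw [← measure_univ (μ := P)]
      congr 1
      ext ω
      rcases hub ω with h | h <;> simp [h, h0, h1]
    · congr 1
      ext ω
      rcases hub ω with h | h <;> simp [h, h0, h1]
    · rw [← prob_compl_eq_one_sub hm]
      congr 1
      ext ω
      rcases hub ω with h | h <;> simp [h, h0, h1]
    · rw [← measure_empty (μ := P)]
      congr 1
      ext ω
      rcases hub ω with h | h <;> simp [h, h0, h1]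
  refine ⟨hf.aemeasurable, hg.aemeasurable, Measure.ext fun s hs => ?_⟩
  rw [Measure.map_apply hf hs, Measure.map_apply hg hs, key hf hfb, key hg hgb, h1]

end Binary

/-! ### Independence of block sums -/

section Independence

variable {Ω ι κ : Type*} [MeasurableSpace Ω] {P : Measure Ω} [IsProbabilityMeasure P]

/-- Sums over disjoint blocks of an independent family are independent. -/
lemma iIndepFun_blockSum [Fintype ι] {X : ι → κ → Ω → ℝ} (hX : ∀ i k, Measurable (X i k))
    (h : iIndepFun (fun q : ι × κ => X q.1 q.2) P) (s : Finset κ) :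
    iIndepFun (fun i ω => ∑ k ∈ s, X i k ω) P := by
  have hm : ∀ i, Measurable fun ω => ∑ k ∈ s, X i k ω := fun i =>
    Finset.measurable_fun_sum _ fun k _ => hX i k
  rw [iIndepFun_iff_charFun_pi fun i => (hm i).aemeasurable]
  intro t
  -- The joint characteristic function at `t` is that of one weighted sum over all pairs at `1`,
  -- which factorises by independence of the whole family.
  have h1 : charFun (P.map fun ω => WithLp.toLp 2 fun i => ∑ k ∈ s, X i k ω) t =
      charFun (P.map fun ω => ∑ q ∈ (Finset.univ : Finset ι) ×ˢ s, t q.1 * X q.1 q.2 ω) 1 := by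
    rw [charFun_apply, charFun_apply, integral_map (by fun_prop) (by fun_prop),
      integral_map (by fun_prop) (by fun_prop)]
    refine integral_congr_ae (ae_of_all _ fun ω => ?_)
    simp [PiLp.inner_apply, Finset.sum_product, Finset.mul_sum]
  have h2 : iIndepFun (fun (q : ι × κ) ω => t q.1 * X q.1 q.2 ω) P :=
    h.comp (fun q x => t q.1 * x) fun q => by fun_prop
  rw [h1, (h2.restrict _).charFun_map_fun_finsetSum_eq_prod fun q _ => by fun_prop,
    Finset.prod_apply, Finset.prod_product]
  refine Finset.prod_congr rfl fun i _ => ?_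
  have h3 : iIndepFun (fun k => X i k) P :=
    h.precomp (g := fun k : κ => (i, k)) fun a b hab => (Prod.ext_iff.1 hab).2
  rw [(h3.restrict _).charFun_map_fun_finsetSum_eq_prod fun k _ => (hX i k).aemeasurable,
    Finset.prod_apply]
  refine Finset.prod_congr rfl fun k _ => ?_
  rw [charFun_map_mul_comp (hX i k).aemeasurable, mul_one]

end Independence

/-! ### Joint convergence in law and continuous mapping -/

section Convergence

variable {Ω Ω' : Type*} [MeasurableSpace Ω] [MeasurableSpace Ω'] {P : Measure Ω}
  [IsProbabilityMeasure P] {P' : Measure Ω'} [IsProbabilityMeasure P']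

/-- Convergence in distribution of independent coordinates implies joint convergence. -/
lemma tendstoInDistribution_pi {ι : Type*} [Fintype ι] {U : ℕ → ι → Ω → ℝ} {N : ι → Ω' → ℝ}
    (hU : ∀ i, TendstoInDistribution (fun n => U n i) atTop (N i) (fun _ => P) P')
    (hUi : ∀ n, iIndepFun (U n) P) (hNi : iIndepFun N P') :
    TendstoInDistribution (fun n ω i => U n i ω) atTop (fun ω i => N i ω) (fun _ => P) P' where
  forall_aemeasurable n := aemeasurable_pi_lambda _ fun i => (hU i).forall_aemeasurable n
  aemeasurable_limit := aemeasurable_pi_lambda _ fun i => (hU i).aemeasurable_limit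
  tendsto := by
    -- By independence the joint laws are product measures, and finite products are weakly
    -- continuous.
    have h := (ProbabilityMeasure.continuous_pi.tendsto _).comp
      (tendsto_pi_nhds.2 fun i => (hU i).tendsto)
    refine le_trans (h.congr fun n => Subtype.ext ?_) (le_of_eq (congrArg 𝓝 (Subtype.ext ?_)))
    · exact ((hUi n).map_fun_eq_pi_map fun i => (hU i).forall_aemeasurable n).symm
    · exact (hNi.map_fun_eq_pi_map fun i => (hU i).aemeasurable_limit).symm

/-- **Continuous mapping theorem** for a measurable map that is continuous off a set which
the limit avoids almost surely. -/
lemma tendstoInDistribution_comp_of_continuousAt {E F : Type*} [TopologicalSpace E]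
    [MeasurableSpace E] [BorelSpace E] [HasOuterApproxClosed E] [TopologicalSpace F]
    [MeasurableSpace F] [BorelSpace F]
    {U : ℕ → Ω → E} {N : Ω' → E} {g : E → F} {A : Set E} (hg : Measurable g)
    (hgA : ∀ x, x ∉ A → ContinuousAt g x)
    (hU : TendstoInDistribution U atTop N (fun _ => P) P') (hN : ∀ᵐ ω ∂P', N ω ∉ A) :
    TendstoInDistribution (fun n ω => g (U n ω)) atTop (fun ω => g (N ω)) (fun _ => P) P' where
  forall_aemeasurable n := hg.comp_aemeasurable (hU.forall_aemeasurable n)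
  aemeasurable_limit := hg.comp_aemeasurable hU.aemeasurable_limit
  tendsto := by
    -- Portmanteau with open sets: off `A`, a point of `g ⁻¹' G` is interior to it, so passing to
    -- the interior loses no mass in the limit.
    refine tendsto_of_forall_isOpen_le_liminf' fun G hG => ?_
    have hO : IsOpen (interior (g ⁻¹' G)) := isOpen_interior
    have h := ProbabilityMeasure.le_liminf_measure_open_of_tendsto hU.tendsto hO
    simp only [ProbabilityMeasure.coe_mk] at h ⊢
    have hgN : AEMeasurable (fun ω => g (N ω)) P' := hg.comp_aemeasurable hU.aemeasurable_limit
    have hgU : ∀ n, AEMeasurable (fun ω => g (U n ω)) P := fun n =>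
      hg.comp_aemeasurable (hU.forall_aemeasurable n)
    rw [Measure.map_apply_of_aemeasurable hgN hG.measurableSet]
    rw [Measure.map_apply_of_aemeasurable hU.aemeasurable_limit hO.measurableSet] at h
    refine le_trans (measure_mono_ae ?_) (h.trans (liminf_le_liminf (.of_forall fun n => ?_)))
    · filter_upwards [hN] with ω hω hmem
      exact mem_interior_iff_mem_nhds.2 ((hgA _ hω).preimage_mem_nhds (hG.mem_nhds hmem))
    · rw [Measure.map_apply_of_aemeasurable (hgU n) hG.measurableSet,
        Measure.map_apply_of_aemeasurable (hU.forall_aemeasurable n) hO.measurableSet]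
      exact measure_mono (Set.preimage_mono (f := U n) interior_subset)

lemma tendstoInDistribution_subseq {E : Type*} [TopologicalSpace E] [MeasurableSpace E]
    [OpensMeasurableSpace E] {U : ℕ → Ω → E} {N : Ω' → E}
    (hU : TendstoInDistribution U atTop N (fun _ => P) P') {φ : ℕ → ℕ}
    (hφ : Tendsto φ atTop atTop) :
    TendstoInDistribution (fun n => U (φ n)) atTop N (fun _ => P) P' where
  forall_aemeasurable n := hU.forall_aemeasurable (φ n)
  aemeasurable_limit := hU.aemeasurable_limit
  tendsto := hU.tendsto.comp hφ

end Convergence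

/-! ### Continuous mapping in probability -/

section ConvergenceInMeasure

/-- A map continuous at a constant preserves convergence in probability of the coordinates to that
constant. -/
lemma tendstoInMeasure_comp_of_continuousAt {Ω ι : Type*} [MeasurableSpace Ω] {P : Measure Ω}
    [Fintype ι] {U : ℕ → ι → Ω → ℝ}
    {e : ι → ℝ} {g : (ι → ℝ) → ℝ} (hg : ContinuousAt g e)
    (hU : ∀ i, TendstoInMeasure P (fun n => U n i) atTop fun _ => e i) :
    TendstoInMeasure P (fun n ω => g (fun i => U n i ω)) atTop fun _ => g e := by
  intro ε hε
  obtain ⟨δ, hδ, h⟩ := (Metric.nhds_basis_eball.tendsto_iff Metric.nhds_basis_eball).1 hg ε hε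
  -- The distance on the product is the maximum over coordinates, so a union bound suffices.
  have hsum : Tendsto (fun n => ∑ i, P {ω | δ ≤ edist (U n i ω) (e i)}) atTop (𝓝 0) := by
    simpa using tendsto_finsetSum Finset.univ fun i _ => hU i δ hδ
  refine tendsto_of_tendsto_of_tendsto_of_le_of_le tendsto_const_nhds hsum
    (fun _ => zero_le) fun n => ?_
  refine le_trans (measure_mono ?_) (measure_iUnion_fintype_le P _)
  intro ω hω
  by_contra hcon
  simp only [Set.mem_iUnion, Set.mem_ofPred_eq, not_exists, not_le] at hcon hω
  refine absurd hω (not_le.2 (h _ ?_))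
  rw [Metric.mem_eball, edist_pi_def, Finset.sup_lt_iff hδ]
  exact fun i _ => hcon i

end ConvergenceInMeasure

/-! ### Gaussian vectors avoid `A` -/

section Gaussian

variable {Ω : Type*} [MeasurableSpace Ω] {P : Measure Ω} [IsProbabilityMeasure P]

/-- A linear combination of independent standard normal variables with some non-zero coefficient
is almost surely non-zero. -/
lemma ae_sum_mul_ne_zero {ι : Type*} [Fintype ι] {N : ι → Ω → ℝ}
    (hN : ∀ i, HasLaw (N i) (gaussianReal 0 1) P) (hNi : iIndepFun N P) (c : ι → ℝ) {i : ι}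
    (hi : c i ≠ 0) : ∀ᵐ ω ∂P, ∑ j, c j * N j ω ≠ 0 := by
  classical
  have hm : ∀ j, AEMeasurable (N j) P := fun j => (hN j).aemeasurable
  set W : Ω → ℝ := ∑ j ∈ Finset.univ.erase i, fun ω => c j * N j ω with hW
  have hind : IndepFun W (N i) P := by
    -- Coefficient `1` at `i` makes `N i` itself appear, independent of `W`. By Fubini the event is
    -- then null: its section over each `w` is at most one point.
    have h1 : iIndepFun (fun j ω => (if j = i then 1 else c j) * N j ω) P :=
      hNi.comp (fun j x => (if j = i then 1 else c j) * x) fun j => by fun_prop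
    have h2 := h1.indepFun_finsetSum_of_notMem₀ (fun j => by fun_prop)
      (Finset.notMem_erase i Finset.univ)
    simp only [if_pos, one_mul] at h2
    convert h2 using 1
    refine Finset.sum_congr rfl fun j hj => ?_
    rw [if_neg (Finset.ne_of_mem_erase hj)]
  have hWm : AEMeasurable W P := Finset.aemeasurable_sum _ fun j _ => by fun_prop
  have hlaw := (indepFun_iff_map_prod_eq_prod_map_map hWm (hm i)).1 hind
  have hS : MeasurableSet {q : ℝ × ℝ | q.1 + c i * q.2 = 0} :=
    measurableSet_eq_fun (by fun_prop) measurable_const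
  have hzero : (P.map W).prod (P.map (N i)) {q : ℝ × ℝ | q.1 + c i * q.2 = 0} = 0 := by
    rw [Measure.measure_prod_null hS]
    refine ae_of_all _ fun w => ?_
    rw [(hN i).map_eq]
    have hsub : Prod.mk w ⁻¹' {q : ℝ × ℝ | q.1 + c i * q.2 = 0} ⊆ {-w / c i} := by
      intro x hx
      simp only [Set.mem_preimage, Set.mem_ofPred_eq] at hx
      rw [Set.mem_singleton_iff, eq_div_iff hi]
      linarith
    have := nullSingletonClass_gaussianReal (μ := 0) (v := 1) one_ne_zero
    exact measure_mono_null hsub (measure_singleton _)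
  rw [← hlaw, Measure.map_apply_of_aemeasurable (hWm.prodMk (hm i)) hS] at hzero
  refine measure_mono_null (fun ω hω => ?_) hzero
  simp only [Set.mem_compl_iff, Set.mem_ofPred_eq, not_not] at hω
  simp only [Set.mem_preimage, Set.mem_ofPred_eq, hW, Finset.sum_apply]
  rw [← hω, Finset.sum_erase_add _ _ (Finset.mem_univ i)]

/-- Independent Gaussians with non-zero weights almost surely avoid `setA`. -/
lemma ae_altScale_notMem_setA {d : ℕ} (hd : 3 ≤ d) {s t : ℝ} (hs : s ≠ 0) (ht : t ≠ 0)
    {N : Fin d → Ω → ℝ} (hN : ∀ i, HasLaw (N i) (gaussianReal 0 1) P) (hNi : iIndepFun N P) :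
    ∀ᵐ ω ∂P, altScale s t (fun i => N i ω) ∉ setA d := by
  -- These are the coefficients of the real part of the transform at `ω_1`; the last cosine is `cos
  -- 2π = 1`.
  set c : Fin d → ℝ := fun l =>
    (if Even (l : ℕ) then s else t) * Real.cos (((l : ℕ) + 1 : ℕ) * freq d 1) with hc
  have hi : c ⟨d - 1, by omega⟩ ≠ 0 := by
    have : (((d - 1 + 1 : ℕ) : ℝ)) * freq d 1 = 2 * Real.pi := by
      have hd0 : (d : ℝ) ≠ 0 := by positivity
      rw [Nat.sub_add_cancel (by omega), freq]
      field_simp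
      simp
    simp only [hc, this, Real.cos_two_pi, mul_one]
    split_ifs <;> assumption
  filter_upwards [ae_sum_mul_ne_zero hN hNi c hi] with ω hω hA
  apply hω
  have h0 := hA 1 (Finset.mem_Icc.2 ⟨le_rfl, by rw [numFreq]; omega⟩)
  rw [periodogram_eq_zero_iff (by omega)] at h0
  have h1 := congrArg Complex.re h0
  rw [Complex.re_sum, Complex.zero_re] at h1
  rw [← h1]
  refine Finset.sum_congr rfl fun l _ => ?_
  have harg : -(Complex.I * (((l : ℕ) + 1 : ℕ) : ℂ) * ((freq d 1 : ℝ) : ℂ)) =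
      ((-((((l : ℕ) + 1 : ℕ) : ℝ) * freq d 1) : ℝ) : ℂ) * Complex.I := by
    push_cast
    ring
  rw [harg, Complex.re_ofReal_mul, Complex.exp_ofReal_mul_I_re, Real.cos_neg]
  simp only [hc, altScale]
  ring

end Gaussian

/-! ### Limit theorems for the blocks -/

section Blocks

variable {Ω : Type*} [MeasurableSpace Ω] {P : Measure Ω} [IsProbabilityMeasure P]
  {Y : ℕ → Ω → ℝ} {p : ℕ → ℝ} {r d : ℕ}

lemma injective_blockIndex (hd : 1 ≤ d) :
    Function.Injective fun q : Fin d × ℕ => (q.1 : ℕ) + q.2 * d := by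
  rintro ⟨i, k⟩ ⟨j, l⟩ h
  simp only at h
  have hi := congrArg (· % d) h
  have hk := congrArg (· / d) h
  simp only [Nat.add_mul_mod_self_right, Nat.mod_eq_of_lt i.2, Nat.mod_eq_of_lt j.2] at hi
  simp only [Nat.add_mul_div_right _ _ hd, Nat.div_eq_of_lt i.2, Nat.div_eq_of_lt j.2,
    zero_add] at hk
  exact Prod.ext (Fin.ext hi) hk

omit [IsProbabilityMeasure P] in
lemma iIndepFun_blocks (hYindep : iIndepFun (fun l : ℕ => Y (l + 1)) P) (hd : 1 ≤ d) :
    iIndepFun (fun q : Fin d × ℕ => Y ((q.1 : ℕ) + 1 + q.2 * d)) P := by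
  have h := hYindep.precomp (injective_blockIndex hd)
  convert h using 2 with q
  exact congrArg Y (by ring)

/-- The weak law of large numbers for the block means. -/
lemma tendstoInMeasure_blockMean
    (hYmeas : ∀ l, 1 ≤ l → Measurable (Y l))
    (hYbin : ∀ l, 1 ≤ l → ∀ ω, Y l ω = 0 ∨ Y l ω = 1)
    (hYindep : iIndepFun (fun l : ℕ => Y (l + 1)) P)
    (hYp : ∀ l, 1 ≤ l → P.real {ω | Y l ω = 1} = p l)
    (hr : IsMinimalPeriod p r) (hd : 1 ≤ d) (i : Fin d) :
    TendstoInMeasure P (fun n => blockMean Y d n ((i : ℕ) + 1)) atTop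
      fun _ => limMean p r d ((i : ℕ) + 1) := by
  set X : ℕ → Ω → ℝ := fun k => Y ((i : ℕ) + 1 + k * d) with hX
  have hXm : ∀ k, Measurable (X k) := fun k => hYmeas _ (by omega)
  have hXb : ∀ k ω, X k ω = 0 ∨ X k ω = 1 := fun k => hYbin _ (by omega)
  have hXL : ∀ k, MemLp (X k) 2 P := fun k => memLp_of_binary (hXm k) (hXb k) 2
  have hXi : iIndepFun X P := (iIndepFun_blocks hYindep hd).precomp
    (g := fun k : ℕ => (i, k)) fun a b hab => (Prod.ext_iff.1 hab).2
  set e := limMean p r d ((i : ℕ) + 1) with he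
  set M : ℕ → Ω → ℝ := fun m => (1 / (m : ℝ)) • ∑ k ∈ Finset.range m, X k with hM
  have hML : ∀ m, MemLp (M m) 2 P := fun m =>
    (memLp_finsetSum' _ fun k _ => hXL k).const_smul _
  have hmean : Tendsto (fun m => P[M m]) atTop (𝓝 e) := by
    have h := tendsto_cesaro_periodic hr.1.1.ne' (hr.periodic (d := d) (i := (i : ℕ) + 1)
      (by omega))
    refine h.congr fun m => ?_
    simp only [hM, Pi.smul_apply, Finset.sum_apply, smul_eq_mul]
    rw [integral_const_mul, integral_finsetSum _ fun k _ => (hXL k).integrable one_le_two]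
    congr 1
    refine Finset.sum_congr rfl fun k _ => ?_
    rw [integral_of_binary (hXm k) (hXb k), hYp _ (by omega)]
  have hvar : ∀ m, Var[M m; P] ≤ 1 / m := by
    intro m
    rw [hM, variance_smul, IndepFun.variance_sum (fun k _ => hXL k)
      fun a _ b _ hab => hXi.indepFun hab]
    have h : ∑ k ∈ Finset.range m, Var[X k; P] ≤ m := by
      calc _ ≤ ∑ k ∈ Finset.range m, (1 : ℝ) :=
            Finset.sum_le_sum fun k _ => variance_le_one_of_binary (hXm k) (hXb k)
        _ = m := by simp
    calc _ ≤ (1 / (m : ℝ)) ^ 2 * m := mul_le_mul_of_nonneg_left h (sq_nonneg _)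
      _ = 1 / m := by
        rcases eq_or_ne m 0 with rfl | hm
        · simp
        · have : (m : ℝ) ≠ 0 := by exact_mod_cast hm
          field_simp
  -- Chebyshev at `ε / 2`, once the expectation of the mean is within `ε / 2` of its limit.
  have hconv : ∀ ε : ℝ, 0 < ε → Tendsto (fun m => P {ω | ε ≤ ‖M m ω - e‖}) atTop (𝓝 0) := by
    intro ε hε
    have hlim : Tendsto (fun m : ℕ => ENNReal.ofReal (1 / m / (ε / 2) ^ 2)) atTop (𝓝 0) := by
      have h := (tendsto_const_div_atTop_nhds_zero_nat (1 : ℝ)).div_const ((ε / 2) ^ 2)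
      rw [zero_div] at h
      simpa using ENNReal.tendsto_ofReal h
    refine tendsto_of_tendsto_of_tendsto_of_le_of_le' tendsto_const_nhds hlim
      (.of_forall fun _ => zero_le) ?_
    filter_upwards [Metric.tendsto_nhds.1 hmean (ε / 2) (half_pos hε)] with m hm
    refine le_trans (measure_mono fun ω hω => ?_)
      ((meas_ge_le_variance_div_sq (hML m) (half_pos hε)).trans
        (ENNReal.ofReal_le_ofReal (div_le_div_of_nonneg_right (hvar m) (by positivity))))
    simp only [Set.mem_ofPred_eq] at hω ⊢
    rw [Real.dist_eq] at hm
    rw [Real.norm_eq_abs] at hω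
    have := abs_sub_le (M m ω) (P[M m]) e
    linarith
  rw [tendstoInMeasure_iff_norm]
  intro ε hε
  refine ((hconv ε hε).comp (Nat.tendsto_div_const_atTop (by omega : d ≠ 0))).congr fun n => ?_
  simp [hM, blockMean, hX]

/-- The joint central limit theorem for the block sums, when the block length is a multiple of the
period. -/
lemma tendstoInDistribution_blockSums
    (hYmeas : ∀ l, 1 ≤ l → Measurable (Y l))
    (hYbin : ∀ l, 1 ≤ l → ∀ ω, Y l ω = 0 ∨ Y l ω = 1)
    (hYindep : iIndepFun (fun l : ℕ => Y (l + 1)) P)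
    (hYp : ∀ l, 1 ≤ l → P.real {ω | Y l ω = 1} = p l)
    (hr : IsMinimalPeriod p r) (hd : 1 ≤ d) (hrd : r ∣ d)
    {Ω' : Type*} [MeasurableSpace Ω'] {P' : Measure Ω'} [IsProbabilityMeasure P']
    {N : Fin d → Ω' → ℝ} (hN : ∀ i, HasLaw (N i) (gaussianReal 0 1) P') (hNi : iIndepFun N P') :
    TendstoInDistribution
      (fun (m : ℕ) ω (i : Fin d) => (√(m : ℝ))⁻¹ *
        (∑ k ∈ Finset.range m, Y ((i : ℕ) + 1 + k * d) ω - m * p ((i : ℕ) + 1)))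
      atTop (fun ω i => √(Var[Y ((i : ℕ) + 1); P]) * N i ω) (fun _ => P) P' := by
  have hblock := iIndepFun_blocks hYindep hd
  -- As `r ∣ d`, the success probability is constant along each block, so the i.i.d. CLT applies.
  have hper : ∀ (i : Fin d) (k : ℕ), p ((i : ℕ) + 1 + k * d) = p ((i : ℕ) + 1) := by
    intro i k
    obtain ⟨c, rfl⟩ := hrd
    rw [show k * (r * c) = (k * c) * r by ring]
    exact hr.add_eq (by omega) _
  refine tendstoInDistribution_pi (U := fun (m : ℕ) (i : Fin d) ω => (√(m : ℝ))⁻¹ *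
        (∑ k ∈ Finset.range m, Y ((i : ℕ) + 1 + k * d) ω - m * p ((i : ℕ) + 1)))
    (N := fun i ω => √(Var[Y ((i : ℕ) + 1); P]) * N i ω) (fun i => ?_) (fun m => ?_) ?_
  · set X : ℕ → Ω → ℝ := fun k => Y ((i : ℕ) + 1 + k * d) with hX
    have hX0 : X 0 = Y ((i : ℕ) + 1) := by simp [hX]
    have hXm : ∀ k, Measurable (X k) := fun k => hYmeas _ (by omega)
    have hXb : ∀ k ω, X k ω = 0 ∨ X k ω = 1 := fun k => hYbin _ (by omega)
    have hXp : ∀ k, P.real {ω | X k ω = 1} = p ((i : ℕ) + 1) := fun k => by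
      rw [hYp _ (by omega), hper]
    have hXi : iIndepFun X P := hblock.precomp
      (g := fun k : ℕ => (i, k)) fun a b hab => (Prod.ext_iff.1 hab).2
    have hlaw : HasLaw (fun ω => √(Var[Y ((i : ℕ) + 1); P]) * N i ω)
        (gaussianReal 0 Var[X 0; P].toNNReal) P' := by
      convert gaussianReal_const_mul (hN i) (√(Var[Y ((i : ℕ) + 1); P])) using 2
      · simp
      · rw [mul_one]
        ext
        rw [hX0, Real.coe_toNNReal _ (variance_nonneg _ _)]
        exact (Real.sq_sqrt (variance_nonneg _ _)).symm
    have h := tendstoInDistribution_inv_sqrt_mul_sum_sub hlaw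
      (memLp_of_binary (hXm 0) (hXb 0) 2) hXi
      fun k => identDistrib_of_binary (hXm k) (hXm 0) (hXb k) (hXb 0) (by rw [hXp, hXp])
    rw [integral_of_binary (hXm 0) (hXb 0), hXp] at h
    exact h
  · exact (iIndepFun_blockSum (X := fun (i : Fin d) k => Y ((i : ℕ) + 1 + k * d))
      (fun i k => hYmeas _ (by omega)) hblock (Finset.range m)).comp
      (fun i x => (√(m : ℝ))⁻¹ * (x - m * p ((i : ℕ) + 1))) fun i => by fun_prop
  · exact hNi.comp (fun i x => √(Var[Y ((i : ℕ) + 1); P]) * x) fun i => by fun_prop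

/-- Along a block all variances agree, and they depend only on `p`. Allowing `l ≠ i` lets `v_1` and
`v_2` serve all odd and even positions. -/
lemma limVar_eq_variance
    (hYmeas : ∀ l, 1 ≤ l → Measurable (Y l))
    (hYbin : ∀ l, 1 ≤ l → ∀ ω, Y l ω = 0 ∨ Y l ω = 1)
    (hYp : ∀ l, 1 ≤ l → P.real {ω | Y l ω = 1} = p l)
    (hr : IsMinimalPeriod p r) (hrd : r ∣ d) {i l : ℕ} (hi : 1 ≤ i) (hl : 1 ≤ l)
    (hil : p l = p i) : limVar P Y r d i = Var[Y l; P] := by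
  have hvar : ∀ l, 1 ≤ l → Var[Y l; P] = p l * (1 - p l) := fun l hl => by
    rw [variance_of_binary (hYmeas l hl) (hYbin l hl), hYp l hl]
  have hr0 : (r : ℝ) ≠ 0 := by exact_mod_cast hr.1.1.ne'
  have h : ∀ j ∈ Finset.range r, Var[Y (i + j * d); P] = Var[Y l; P] := by
    intro j _
    obtain ⟨c, rfl⟩ := hrd
    rw [hvar _ (by omega), hvar l hl, hil, show j * (r * c) = (j * c) * r by ring, hr.add_eq hi]
  rw [limVar, Finset.sum_congr rfl h, Finset.sum_const, Finset.card_range, nsmul_eq_mul]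
  field_simp

lemma limMean_eq (hr : IsMinimalPeriod p r) (hrd : r ∣ d) {i : ℕ} (hi : 1 ≤ i) :
    limMean p r d i = p i := by
  have hr0 : (r : ℝ) ≠ 0 := by exact_mod_cast hr.1.1.ne'
  have h : ∀ j ∈ Finset.range r, p (i + j * d) = p i := by
    intro j _
    obtain ⟨c, rfl⟩ := hrd
    rw [show j * (r * c) = (j * c) * r by ring, hr.add_eq hi]
  rw [limMean, Finset.sum_congr rfl h, Finset.sum_const, Finset.card_range, nsmul_eq_mul]
  field_simp

end Blocks

/-! ### Period two, normalisation and the main theorem -/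

lemma eq_ite_of_period_two {p : ℕ → ℝ} (hr : IsMinimalPeriod p 2) (i : ℕ) :
    p (i + 1) = if Even i then p 1 else p 2 := by
  split_ifs with h
  · obtain ⟨k, rfl⟩ := h
    rw [show k + k + 1 = 1 + k * 2 by ring, hr.add_eq le_rfl]
  · obtain ⟨k, rfl⟩ := Nat.not_even_iff_odd.1 h
    rw [show 2 * k + 1 + 1 = 2 + k * 2 by ring, hr.add_eq one_le_two]

/-- Fisher's statistic of the block means is that of the normalised block sums. -/
lemma testStat_blockSeries_eq {Ω : Type*} {Y : ℕ → Ω → ℝ} {p : ℕ → ℝ} {d : ℕ}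
    (he : (fun i : Fin d => p ((i : ℕ) + 1)) ∈ setA d) (n : ℕ)
    (ω : Ω) :
    testStat (blockSeries Y d n ω) = fisherG fun i : Fin d => (√((n / d : ℕ) : ℝ))⁻¹ *
      (∑ k ∈ Finset.range (n / d), Y ((i : ℕ) + 1 + k * d) ω -
        (n / d : ℕ) * p ((i : ℕ) + 1)) := by
  rw [testStat_eq_fisherG]
  rcases Nat.eq_zero_or_pos (n / d) with h | h
  -- For `n < d` both arguments are the zero vector, since the inverse of `0` is `0`.
  · congr 1
    ext i
    simp [blockSeries, blockMean, h]
  · have hm : (0 : ℝ) < ((n / d : ℕ) : ℝ) := by exact_mod_cast h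
    rw [← fisherG_smul_sub he (Real.sqrt_pos.2 hm).ne' (blockSeries Y d n ω)]
    congr 1
    ext i
    have hsq := Real.mul_self_sqrt hm.le
    have hne := (Real.sqrt_pos.2 hm).ne'
    simp only [Pi.smul_apply, Pi.sub_apply, smul_eq_mul, blockSeries, blockMean]
    rw [eq_inv_mul_iff_mul_eq₀ hne, ← mul_assoc, hsq]
    field_simp

end PeriodTest

theorem mainTheorem4
    {Ω : Type*} [MeasurableSpace Ω] (P : Measure Ω) [IsProbabilityMeasure P]
    (Y : ℕ → Ω → ℝ) (p : ℕ → ℝ) (r d : ℕ)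
    (hYmeas : ∀ l, 1 ≤ l → Measurable (Y l))
    (hYbin : ∀ l, 1 ≤ l → ∀ ω, Y l ω = 0 ∨ Y l ω = 1)
    (hYindep : iIndepFun (fun l : ℕ => Y (l + 1)) P)
    (hYp : ∀ l, 1 ≤ l → P.real {ω | Y l ω = 1} = p l)
    (hp : ∀ l, 1 ≤ l → p l ∈ Set.Ioo (0 : ℝ) 1)
    (hr : PeriodTest.IsMinimalPeriod p r)
    (hd : 1 ≤ d)
    (hrd : 1 < Nat.gcd r d) :
    (r = 2 →
      PeriodTest.limSeries p r d ∈ PeriodTest.setA d ∧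
      ∀ {Ω' : Type*} [MeasurableSpace Ω'] (P' : Measure Ω') [IsProbabilityMeasure P']
        (N : Fin d → Ω' → ℝ),
        (∀ i, HasLaw (N i) (gaussianReal 0 1) P') → iIndepFun N P' →
        (3 ≤ d → ∀ᵐ ω ∂P',
          PeriodTest.altScale (√(PeriodTest.limVar P Y r d 1)) (√(PeriodTest.limVar P Y r d 2))
            (fun i => N i ω) ∉ PeriodTest.setA d) ∧
        TendstoInDistribution
          (fun (n : ℕ) ω => PeriodTest.testStat (PeriodTest.blockSeries Y d n ω)) atTop
          (fun ω => PeriodTest.fisherG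
            (PeriodTest.altScale (√(PeriodTest.limVar P Y r d 1)) (√(PeriodTest.limVar P Y r d 2))
              (fun i => N i ω)))
          (fun _ => P) P') ∧
    (3 ≤ r → 3 ≤ Nat.gcd r d →
      ∑ k ∈ Finset.Icc 1 r,
        (PeriodTest.limMean p r d k : ℂ) *
          Complex.exp (-(2 * (Real.pi : ℂ) * Complex.I * (k : ℂ) / (Nat.gcd r d : ℂ))) *
          ((⌊((d : ℝ) - (k : ℝ)) / (r : ℝ)⌋ + 1 : ℤ) : ℂ) ≠ 0 →
      PeriodTest.limSeries p r d ∉ PeriodTest.setA d ∧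
      TendstoInMeasure P
        (fun (n : ℕ) ω => PeriodTest.testStat (PeriodTest.blockSeries Y d n ω)) atTop
        (fun _ => PeriodTest.fisherG (PeriodTest.limSeries p r d))) := by
  refine ⟨?_, fun _ hb hne => ?_⟩
  · rintro rfl
    have h2d : 2 ∣ d := by
      rcases (Nat.dvd_prime Nat.prime_two).1 (Nat.gcd_dvd_left 2 d) with h | h
      · omega
      · exact h ▸ Nat.gcd_dvd_right 2 d
    have hlim : PeriodTest.limSeries p 2 d = fun i : Fin d => p ((i : ℕ) + 1) :=
      funext fun i => PeriodTest.limMean_eq hr h2d (by omega)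
    have hA : (fun i : Fin d => p ((i : ℕ) + 1)) ∈ PeriodTest.setA d :=
      PeriodTest.mem_setA_of_alternating (even_iff_two_dvd.2 h2d)
        fun i => PeriodTest.eq_ite_of_period_two hr i
    refine ⟨hlim ▸ hA, fun {Ω'} _ P' _ N hN hNi => ?_⟩
    have hv : ∀ i, 1 ≤ i → PeriodTest.limVar P Y 2 d i = p i * (1 - p i) := fun i hi => by
      rw [PeriodTest.limVar_eq_variance hYmeas hYbin hYp hr h2d hi hi rfl,
        PeriodTest.variance_of_binary (hYmeas i hi) (hYbin i hi), hYp i hi]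
    have hs : ∀ i, 1 ≤ i → √(PeriodTest.limVar P Y 2 d i) ≠ 0 := fun i hi => by
      rw [hv i hi]
      exact (Real.sqrt_pos.2 (mul_pos (hp i hi).1 (sub_pos.2 (hp i hi).2))).ne'
    have hae : 3 ≤ d → ∀ᵐ ω ∂P', PeriodTest.altScale (√(PeriodTest.limVar P Y 2 d 1))
        (√(PeriodTest.limVar P Y 2 d 2)) (fun i => N i ω) ∉ PeriodTest.setA d := fun h3 =>
      PeriodTest.ae_altScale_notMem_setA h3 (hs 1 le_rfl) (hs 2 one_le_two) hN hNi
    refine ⟨hae, ?_⟩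
    have hclt := PeriodTest.tendstoInDistribution_blockSums hYmeas hYbin hYindep hYp hr hd h2d
      hN hNi
    have halt : (fun ω (i : Fin d) => √(Var[Y ((i : ℕ) + 1); P]) * N i ω) =
        fun ω => PeriodTest.altScale (√(PeriodTest.limVar P Y 2 d 1))
          (√(PeriodTest.limVar P Y 2 d 2)) (fun i => N i ω) := by
      ext ω i
      have hpi := PeriodTest.eq_ite_of_period_two hr i
      simp only [PeriodTest.altScale]
      split_ifs at hpi ⊢
      · rw [PeriodTest.limVar_eq_variance hYmeas hYbin hYp hr h2d le_rfl (by omega) hpi]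
      · rw [PeriodTest.limVar_eq_variance hYmeas hYbin hYp hr h2d one_le_two (by omega) hpi]
    rw [halt] at hclt
    simp_rw [PeriodTest.testStat_blockSeries_eq hA]
    have hsub := PeriodTest.tendstoInDistribution_subseq hclt
      (Nat.tendsto_div_const_atTop (by omega : d ≠ 0))
    -- For `d < 3` the set `A` is the whole space and cannot be avoided, but then `g` is identically
    -- `0`.
    rcases Nat.lt_or_ge d 3 with h3 | h3
    · have hq : PeriodTest.numFreq d = 0 := by
        rw [PeriodTest.numFreq]
        omega
      have hg : Continuous (PeriodTest.fisherG : (Fin d → ℝ) → ℝ) := by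
        have h0 : (PeriodTest.fisherG : (Fin d → ℝ) → ℝ) = fun _ => 0 := by
          ext x
          simp [PeriodTest.fisherG, hq]
        rw [h0]
        exact continuous_const
      exact hsub.continuous_comp hg
    · exact PeriodTest.tendstoInDistribution_comp_of_continuousAt PeriodTest.measurable_fisherG
        (fun x hx => PeriodTest.continuousAt_fisherG hx) hsub (hae h3)
  · have hA := PeriodTest.limSeries_notMem_setA hr hd hb hne
    refine ⟨hA, ?_⟩
    simp_rw [PeriodTest.testStat_eq_fisherG]
    exact PeriodTest.tendstoInMeasure_comp_of_continuousAt (PeriodTest.continuousAt_fisherG hA)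
      fun i => PeriodTest.tendstoInMeasure_blockMean hYmeas hYbin hYindep hYp hr hd i
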